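/- A \emph{metric graph} $\Gamma$ is obtained from a finite connected nonempty multigraph (loops and multiple edges allowed) with vertex set $V(\Gamma)$ by gluing, for each edge $e$, a segment $[0,\ell(e)]$ with $0<\ell(e)\le\infty$ to the end vertices of $e$; an edge of infinite length ends in a $1$-valent \emph{infinite vertex} at $\infty$. A \emph{divisor} is a finite formal $\mathbb{Z}$-linear combination $D$ of points of $\Gamma$, with degree the sum of its coefficients; it is effective if all coefficients are $\ge 0$. A \emph{rational function} is a continuous piecewise linear function $f$ on $\Gamma$ with integer slopes and finitely many pieces, real valued except that the values $\pm\infty$ are allowed at infinite vertices; $\operatorname{div}(f)$ has at each point the sum of the outgoing slopes of $f$ as coefficient. Write $D_1\sim D_2$ if $D_1-D_2=\operatorname{div}(f)$ for some rational function $f$, and let $|D|$ be the set of effective divisors equivalent to $D$. The rank of $D$ is $-1$ if $|D|=\emptyset$, and otherwise the largest $r\ge 0$ such that $|D-E|\neq\emptyset$ for all effective divisors $E$ of degree $r$. The \emph{gonality} $\operatorname{gon}(\Gamma)$ is the smallest degree of a divisor of rank $1$. (a) Let $\Gamma$ be a metric graph and let $v_1,\dots,v_n\in V(\Gamma)$ be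 distinct vertices such that for all $i\ne j$ there are $n-1$ paths in $\Gamma$ from $v_i$ to $v_j$ which are pairwise disjoint except at their end points. Then $\operatorname{gon}(\Gamma)\ge n-1$. (b) Let $\Gamma$ be a metric graph that contains as a subgraph the complete metric graph $K_d$ on $d$ vertices, with arbitrary edge lengths; that is, $\Gamma$ has $d$ distinct vertices, each two of which are joined by a path in $\Gamma$ (which may pass through further vertices of $\Gamma$), all these paths being disjoint except at their end points. Then $\operatorname{gon}(\Gamma)\ge d-1$. -/

import Mathlib

open Topology

/-- A metric graph, presented by a vertex set: `V` is a finite nonempty set of vertices, `E` a finite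
set of edges (loops and multiple edges are allowed), and every edge `e` is a segment
`[0, len e]` glued to `src e` at `0` and to `tgt e` at `len e`, where `0 < len e ≤ ∞`.
An edge of infinite length ends (at its target) in an infinite vertex, which is `1`-valent.
The graph is connected. The order of the two ends of an edge is only a choice of coordinate.
Every finite set of points containing the essential vertices may serve as `V`
(a segment with two infinite ends needs one more vertex in its interior). -/
structure MetricGraph where
  V : Type
  E : Type
  [fintypeV : Fintype V]
  [fintypeE : Fintype E]
  [nonemptyV : Nonempty V]
  src : E → V
  tgt : E → V
  len : E → EReal
  len_pos : ∀ e, 0 < len e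
  infinite_end : ∀ e, len e = ⊤ → (∀ e', src e' ≠ tgt e) ∧ ∀ e', tgt e' = tgt e → e' = e
  connected : ∀ u w : V, Relation.EqvGen (fun x y => ∃ e, src e = x ∧ tgt e = y) u w

namespace MetricGraph

attribute [instance] fintypeV fintypeE nonemptyV

variable (Γ : MetricGraph)

/-! ### Points and tangent directions -/

/-- The points of the metric graph: the vertices, and the points in the interiors of the edges. -/
inductive Point where
  | vertex (v : Γ.V) : Point
  | interior (e : Γ.E) (t : ℝ) (pos : 0 < t) (lt : (t : EReal) < Γ.len e) : Point

/-- The parametrization `[0, len e] → Γ` of the closed edge `e`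
(outside of `[0, len e]` it is extended by the end points). -/
noncomputable def edgePoint (e : Γ.E) (x : EReal) : Γ.Point :=
  if h : 0 < x ∧ x < Γ.len e then
    .interior e x.toReal
      (EReal.toReal_pos h.1 (ne_top_of_lt h.2))
      (by rw [EReal.coe_toReal (ne_top_of_lt h.2) (ne_bot_of_gt h.1)]; exact h.2)
  else if x ≤ 0 then .vertex (Γ.src e) else .vertex (Γ.tgt e)

/-- An oriented edge: `(e, true)` runs from `src e` to `tgt e`, and `(e, false)` backwards. -/
abbrev Dart := Γ.E × Bool

/-- The vertex at which an oriented edge starts. -/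
def Dart.start {Γ : MetricGraph} (d : Γ.Dart) : Γ.V := if d.2 then Γ.src d.1 else Γ.tgt d.1

/-- The vertex at which an oriented edge ends. -/
def Dart.finish {Γ : MetricGraph} (d : Γ.Dart) : Γ.V := if d.2 then Γ.tgt d.1 else Γ.src d.1

open Classical in
/-- The tangent directions at a point: at a vertex, the oriented edges that start there (a loop
counts twice); at a point in the interior of an edge, the two orientations of this edge. -/
noncomputable def directions : Γ.Point → Finset Γ.Dart
  | .vertex v => Finset.univ.filter fun d => Dart.start d = v
  | .interior e _ _ _ => Finset.univ.filter fun d => d.1 = e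

/-- The coordinate, on the edge underlying `d`, of a point `p` at which `d` is a direction. -/
noncomputable def coord : Γ.Point → Γ.Dart → EReal
  | .vertex _, d => if d.2 then 0 else Γ.len d.1
  | .interior _ t _ _, _ => (t : EReal)

/-- The coordinates, on the edge underlying `d`, of the points close to `p` (and different from it)
in the tangent direction `d` at `p`. -/
noncomputable def germ (p : Γ.Point) (d : Γ.Dart) : Filter EReal :=
  if d.2 then 𝓝[>] (Γ.coord p d) else 𝓝[<] (Γ.coord p d)

/-- The infinite vertices, as points. -/
def IsInfinite (p : Γ.Point) : Prop := ∃ e, Γ.len e = ⊤ ∧ p = .vertex (Γ.tgt e)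

/-! ### Rational functions and divisors -/

/-- Rational functions: continuous functions, real valued except that `±∞` is allowed as a value
at the infinite vertices, which are piecewise linear with integer slopes and
finitely many pieces: on every edge there is a finite set `S` of break points such that the function
is affine with integer slope on each interval in the interior of the edge that avoids `S`. -/
structure IsRational (f : Γ.Point → EReal) : Prop where
  finite : ∀ p, ¬ Γ.IsInfinite p → f p ≠ ⊤ ∧ f p ≠ ⊥
  continuous : ∀ e, ContinuousOn (fun x => f (Γ.edgePoint e x)) (Set.Icc 0 (Γ.len e))
  piecewise_linear : ∀ e, ∃ S : Finset ℝ, ∀ I : Set ℝ, I.OrdConnected →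
    (∀ t ∈ I, 0 < t ∧ (t : EReal) < Γ.len e ∧ t ∉ S) →
      ∃ (m : ℤ) (c : ℝ), ∀ t ∈ I, f (Γ.edgePoint e t) = ((m * t + c : ℝ) : EReal)

/-- The slope of `f` at `p` in the tangent direction `d`, directed away from `p`, is `m`. -/
def HasOutgoingSlope (f : Γ.Point → EReal) (p : Γ.Point) (d : Γ.Dart) (m : ℤ) : Prop :=
  ∃ c : ℝ, ∀ᶠ x in Γ.germ p d,
    f (Γ.edgePoint d.1 x) = (((if d.2 then (m : ℝ) else -m) * x.toReal + c : ℝ) : EReal)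

/-- Divisors: the free abelian group on the points. -/
abbrev Divisor := Γ.Point →₀ ℤ

/-- The degree of a divisor. -/
noncomputable def deg (D : Γ.Divisor) : ℤ := D.sum fun _ a => a

/-- `D = div(f)`: the coefficient of `D` at each point is the sum of the outgoing slopes of `f`. -/
def IsDivisorOf (D : Γ.Divisor) (f : Γ.Point → EReal) : Prop :=
  ∃ slope : Γ.Point → Γ.Dart → ℤ,
    (∀ p, ∀ d ∈ Γ.directions p, Γ.HasOutgoingSlope f p d (slope p d)) ∧
      ∀ p, D p = ∑ d ∈ Γ.directions p, slope p d

/-- Linear equivalence of divisors. -/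
def LinEquiv (D₁ D₂ : Γ.Divisor) : Prop :=
  ∃ f, Γ.IsRational f ∧ Γ.IsDivisorOf (D₁ - D₂) f

/-- The linear system `|D|`: the effective divisors linearly equivalent to `D`. -/
def linearSystem (D : Γ.Divisor) : Set Γ.Divisor := {D' | 0 ≤ D' ∧ Γ.LinEquiv D' D}

open Classical in
/-- The rank of a divisor. -/
noncomputable def rank (D : Γ.Divisor) : ℤ :=
  if Γ.linearSystem D = ∅ then -1
  else ((sSup {r : ℕ | ∀ D' : Γ.Divisor, 0 ≤ D' → Γ.deg D' = r →
    (Γ.linearSystem (D - D')).Nonempty} : ℕ) : ℤ)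

/-- The gonality: the smallest `d` for which there is a divisor of degree `d` and rank `1`.
(A divisor of rank `1` has nonnegative degree. The infimum is taken in `ℕ∞`, so that it
has no default value other than `∞`.) -/
noncomputable def gonality : ℕ∞ :=
  sInf {x : ℕ∞ | ∃ (d : ℕ) (D : Γ.Divisor), Γ.deg D = d ∧ Γ.rank D = 1 ∧ x = d}

/-! ### Paths -/

/-- Walks along the edges of the graph. -/
inductive Walk : Γ.V → Γ.V → Type
  | nil (u : Γ.V) : Walk u u
  | cons {u v w : Γ.V} (d : Γ.Dart) (hu : Dart.start d = u) (hv : Dart.finish d = v)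
      (p : Walk v w) : Walk u w

namespace Walk

variable {Γ}

/-- The vertices on a walk. -/
def support {u w : Γ.V} : Γ.Walk u w → List Γ.V
  | nil u => [u]
  | cons (u := u) _ _ _ p => u :: p.support

/-- The edges on a walk. -/
def edges {u w : Γ.V} : Γ.Walk u w → List Γ.E
  | nil _ => []
  | cons d _ _ p => d.1 :: p.edges

/-- A path is a walk without repeated vertices. -/
def IsPath {u w : Γ.V} (p : Γ.Walk u w) : Prop := p.support.Nodup

/-- Two paths, as subsets of the metric graph, have at most end points in common: they share no edge,
and each vertex on both of them is an end point of both. -/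
def DisjointExceptEnds {u w u' w' : Γ.V} (p : Γ.Walk u w) (q : Γ.Walk u' w') : Prop :=
  (∀ e ∈ p.edges, e ∉ q.edges) ∧
    ∀ x ∈ p.support, x ∈ q.support → (x = u ∨ x = w) ∧ (x = u' ∨ x = w')

end Walk

/-- The metric graph contains the complete graph on `d` vertices, with edges of arbitrary lengths, as
a subgraph: there are `d` distinct vertices and, for each two of them, a segment (a path, which may
run through further vertices of the ambient graph) joining them, such that these segments are
disjoint except at their end points. -/
def ContainsComplete (d : ℕ) : Prop :=
  ∃ (v : Fin d → Γ.V) (P : ∀ i j, Γ.Walk (v i) (v j)), Function.Injective v ∧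
    (∀ i j, i < j → (P i j).IsPath) ∧
    ∀ i j k l, i < j → k < l → (i, j) ≠ (k, l) → (P i j).DisjointExceptEnds (P k l)

end MetricGraph

/-!
A divisor `D` of rank `1` is equivalent to effective divisors through every point. Let `E` and
`E' = E + div(f)` be effective divisors equivalent to `D`. For every real `t` the truncated function
`max f t` gives a third one, `G = E + div(max f t)` (`PLFun.exists_effective_maxConst`), with the
following properties.

* If `t` is not a value of `f` at a vertex, then every edge whose ends lie on different sides of the
  level `t` carries a chip of `G` in its interior. Hence, if `f` separates two vertices, then `deg D` is
  at least the size of an edge cut between them (`le_deg_of_val_lt`).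
* At the points where `f = t`, the divisor `G` dominates both `E` and `E'`.

Let `v 1, …, v n` be vertices such that all edge cuts between them have at least `n - 1` edges, and
suppose that `deg D < n - 1`. By the first property `f` has the same value at all `v i`, for all `E`
and `E'`; by the second one, truncating at this value combines the vertices contained in `E` with those
contained in `E'`. Repeating this, some effective divisor equivalent to `D` contains all `v i` and has
degree at least `n`, a contradiction (`le_deg_of_cuts`).

Disjoint paths, and the segments of a complete graph, show that the cuts have `n - 1` edges. Only the
disjointness of their edges matters here.

Rational functions may be infinite at the infinite vertices, so that differences of them are not
defined pointwise. The argument therefore works with real valued functions `PLFun`, whose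
values at infinite vertices carry no information; divisors depend only on the slopes. That principal
divisors have degree zero is proved edge by edge (`IsPiecewiseAffine.sum_slopes_eq_zero`).
-/

namespace MetricGraph

open Filter Set

/-! ### One-sided filters on the real line -/

/-- A filter on `ℝ` whose members approach an end of `ℝ`, or a real number from one side. -/
def IsOneSided (F : Filter ℝ) : Prop :=
  F.NeBot ∧ ∀ r : ℝ, (∀ᶠ x in F, x < r) ∨ ∀ᶠ x in F, r < x

theorem IsOneSided.eventually_ne {F : Filter ℝ} (hF : IsOneSided F) (r : ℝ) :
    ∀ᶠ x in F, x ≠ r := by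
  rcases hF.2 r with h | h
  · exact h.mono fun _ hx => hx.ne
  · exact h.mono fun _ hx => hx.ne'

theorem IsOneSided.slope_unique {F : Filter ℝ} (hF : IsOneSided F) {g : ℝ → ℝ} {m m' c c' : ℝ}
    (h : ∀ᶠ x in F, g x = m * x + c) (h' : ∀ᶠ x in F, g x = m' * x + c') : m = m' := by
  by_contra hne
  have := hF.1
  obtain ⟨x, h1, h2, h3⟩ := (h.and (h'.and (hF.eventually_ne ((c' - c) / (m - m'))))).exists
  apply h3
  rw [eq_div_iff (sub_ne_zero.2 hne)]
  linarith

theorem IsOneSided.le_or_le {F : Filter ℝ} (hF : IsOneSided F) {g : ℝ → ℝ} {m c : ℝ}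
    (h : ∀ᶠ x in F, g x = m * x + c) (t : ℝ) :
    (∀ᶠ x in F, t ≤ g x) ∨ ∀ᶠ x in F, g x ≤ t := by
  rcases lt_trichotomy m 0 with hm | rfl | hm
  · rcases hF.2 ((t - c) / m) with h' | h'
    · left
      filter_upwards [h, h'] with x hx hx'
      rw [lt_div_iff_of_neg hm] at hx'
      linarith
    · right
      filter_upwards [h, h'] with x hx hx'
      rw [div_lt_iff_of_neg hm] at hx'
      linarith
  · rcases le_total t c with h' | h'
    · left
      filter_upwards [h] with x hx
      linarith
    · right
      filter_upwards [h] with x hx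
      linarith
  · rcases hF.2 ((t - c) / m) with h' | h'
    · right
      filter_upwards [h, h'] with x hx hx'
      rw [lt_div_iff₀ hm] at hx'
      linarith
    · left
      filter_upwards [h, h'] with x hx hx'
      rw [div_lt_iff₀ hm] at hx'
      linarith

/-- The real numbers close to `a` on its right. -/
noncomputable def rightOf (a : EReal) : Filter ℝ := comap Real.toEReal (𝓝[>] a)

/-- The real numbers close to `a` on its left. -/
noncomputable def leftOf (a : EReal) : Filter ℝ := comap Real.toEReal (𝓝[<] a)

theorem eventually_rightOf {a b : EReal} (h : a < b) : ∀ᶠ x : ℝ in rightOf a, a < x ∧ x < b :=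
  Eventually.comap (Ioo_mem_nhdsGT h) Real.toEReal |>.mono fun _ hx => hx

theorem eventually_leftOf {a b : EReal} (h : b < a) : ∀ᶠ x : ℝ in leftOf a, b < x ∧ x < a :=
  Eventually.comap (Ioo_mem_nhdsLT h) Real.toEReal |>.mono fun _ hx => hx

theorem isOneSided_rightOf {a : EReal} (ha : a < ⊤) : IsOneSided (rightOf a) := by
  refine ⟨comap_neBot_iff.2 fun s hs => ?_, fun r => ?_⟩
  · obtain ⟨u, hu, hs⟩ := (mem_nhdsGT_iff_exists_Ioo_subset' ha).1 hs
    obtain ⟨x, h1, h2⟩ := EReal.lt_iff_exists_real_btwn.1 hu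
    exact ⟨x, hs ⟨h1, h2⟩⟩
  · rcases lt_or_ge a r with h | h
    · exact .inl <| (eventually_rightOf h).mono fun x hx => EReal.coe_lt_coe_iff.1 hx.2
    · exact .inr <| (eventually_rightOf ha).mono fun x hx =>
        EReal.coe_lt_coe_iff.1 (h.trans_lt hx.1)

theorem isOneSided_leftOf {a : EReal} (ha : ⊥ < a) : IsOneSided (leftOf a) := by
  refine ⟨comap_neBot_iff.2 fun s hs => ?_, fun r => ?_⟩
  · obtain ⟨u, hu, hs⟩ := (mem_nhdsLT_iff_exists_Ioo_subset' ha).1 hs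
    obtain ⟨x, h1, h2⟩ := EReal.lt_iff_exists_real_btwn.1 hu
    exact ⟨x, hs ⟨h1, h2⟩⟩
  · rcases lt_or_ge (r : EReal) a with h | h
    · exact .inr <| (eventually_leftOf h).mono fun x hx => EReal.coe_lt_coe_iff.1 hx.1
    · exact .inl <| (eventually_leftOf ha).mono fun x hx =>
        EReal.coe_lt_coe_iff.1 (hx.2.trans_le h)

theorem rightOf_coe (a : ℝ) : rightOf a = 𝓝[>] a := by
  have : Real.toEReal ⁻¹' Ioi (a : EReal) = Ioi a := by ext; simp
  rw [rightOf, nhdsWithin, comap_inf, comap_principal, this,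
    ← EReal.isEmbedding_coe.nhds_eq_comap, nhdsWithin]

theorem leftOf_coe (a : ℝ) : leftOf a = 𝓝[<] a := by
  have : Real.toEReal ⁻¹' Iio (a : EReal) = Iio a := by ext; simp
  rw [leftOf, nhdsWithin, comap_inf, comap_principal, this,
    ← EReal.isEmbedding_coe.nhds_eq_comap, nhdsWithin]

/-! ### Piecewise affine functions on an interval -/

/-- The function `g` is affine with integer slope on every interval in `U` that avoids `S`. -/
def IsPiecewiseAffine (g : ℝ → ℝ) (U : Set ℝ) (S : Finset ℝ) : Prop :=
  ∀ I : Set ℝ, I.OrdConnected → (∀ x ∈ I, x ∈ U ∧ x ∉ S) →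
    ∃ (m : ℤ) (c : ℝ), ∀ x ∈ I, g x = m * x + c

theorem IsPiecewiseAffine.sub {g h : ℝ → ℝ} {U : Set ℝ} {S T : Finset ℝ}
    (hg : IsPiecewiseAffine g U S) (hh : IsPiecewiseAffine h U T) :
    IsPiecewiseAffine (fun x => g x - h x) U (S ∪ T) := by
  intro I hI hU
  obtain ⟨m, c, h1⟩ := hg I hI fun x hx => ⟨(hU x hx).1, fun h => (hU x hx).2 (by simp [h])⟩
  obtain ⟨m', c', h2⟩ := hh I hI fun x hx => ⟨(hU x hx).1, fun h => (hU x hx).2 (by simp [h])⟩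
  refine ⟨m - m', c - c', fun x hx => ?_⟩
  simp only [h1 x hx, h2 x hx]
  push_cast
  ring

theorem IsPiecewiseAffine.max_const {g : ℝ → ℝ} {U : Set ℝ} {S : Finset ℝ}
    (hg : IsPiecewiseAffine g U S) (hU : U.OrdConnected) (t : ℝ) :
    ∃ T : Finset ℝ, IsPiecewiseAffine (fun x => max (g x) t) U T := by
  classical
  -- The pieces of `U \ S` are indexed by the set `A` of break points to the left.
  have key : ∀ A : Finset ℝ, ∃ (m : ℤ) (c : ℝ),
      ∀ x, x ∈ U → x ∉ S → S.filter (· < x) = A → g x = m * x + c := by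
    intro A
    obtain ⟨m, c, h⟩ := hg {x | x ∈ U ∧ x ∉ S ∧ S.filter (· < x) = A} ⟨by
      rintro x ⟨hx, hxS, hxA⟩ y ⟨hy, hyS, hyA⟩ z ⟨hxz, hzy⟩
      have hmem : ∀ w ∈ S, w < y → w < x := fun w hw hwy => by
        have : w ∈ S.filter (· < y) := by simp [hw, hwy]
        rw [hyA, ← hxA] at this
        simpa [hw] using this
      refine ⟨hU.out hx hy ⟨hxz, hzy⟩, fun hzS => ?_, ?_⟩
      · have hlt : z < y := lt_of_le_of_ne hzy fun h => hyS (h ▸ hzS)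
        exact absurd (hmem z hzS hlt) (not_lt.2 hxz)
      · rw [← hxA]
        ext w
        simp only [Finset.mem_filter, and_congr_right_iff]
        exact fun hw => ⟨fun h => hmem w hw (h.trans_le hzy), fun h => h.trans_le hxz⟩⟩
      (fun x hx => ⟨hx.1, hx.2.1⟩)
    exact ⟨m, c, fun x h1 h2 h3 => h x ⟨h1, h2, h3⟩⟩
  choose m c hmc using key
  refine ⟨S ∪ S.powerset.image fun A => (t - c A) / m A, fun I hI hIU => ?_⟩
  rcases I.eq_empty_or_nonempty with rfl | ⟨x₀, hx₀⟩
  · exact ⟨0, 0, by simp⟩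
  set A := S.filter (· < x₀) with hA
  have hS : ∀ x ∈ I, x ∉ S := fun x hx h => (hIU x hx).2 (by simp [h])
  have haff : ∀ x ∈ I, g x = m A * x + c A := by
    intro x hx
    refine hmc A x (hIU x hx).1 (hS x hx) ?_
    rw [hA]
    ext w
    simp only [Finset.mem_filter, and_congr_right_iff]
    intro hw
    by_contra hne
    refine hS w (hI.uIcc_subset hx hx₀ ?_) hw
    rw [mem_uIcc]
    by_cases h : w < x
    · exact .inr ⟨not_lt.1 fun h' => hne (by simp [h, h']), h.le⟩
    · exact .inl ⟨not_lt.1 h, (not_le.1 fun h' => hne (by simp [h, h'])).le⟩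
  have hr : (t - c A) / m A ∉ I := fun h => (hIU _ h).2 (by
    refine Finset.mem_union_right _ (Finset.mem_image.2 ⟨A, ?_, rfl⟩)
    simp [hA])
  have hdich : (∀ x ∈ I, t ≤ g x) ∨ ∀ x ∈ I, g x ≤ t := by
    by_contra! hcon
    obtain ⟨⟨x, hx, hxt⟩, y, hy, hyt⟩ := hcon
    apply hr
    rw [haff x hx] at hxt
    rw [haff y hy] at hyt
    refine hI.uIcc_subset hx hy (mem_uIcc.2 ?_)
    rcases lt_trichotomy (m A : ℝ) 0 with h | h | h
    · right
      rw [div_le_iff_of_neg h, le_div_iff_of_neg h]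
      constructor <;> linarith
    · rw [h] at hxt hyt
      linarith
    · left
      rw [div_le_iff₀ h, le_div_iff₀ h]
      constructor <;> linarith
  rcases hdich with h | h
  · exact ⟨m A, c A, fun x hx => (max_eq_left (h x hx)).trans (haff x hx)⟩
  · exact ⟨0, t, fun x hx => (max_eq_right (h x hx)).trans (by simp)⟩

/-- The slopes of a piecewise affine function on `(0, b)`, taken away from the ends and in both
directions away from the break points, cancel: on each piece the slopes at its two ends are
opposite. -/
theorem IsPiecewiseAffine.sum_slopes_eq_zero {g : ℝ → ℝ} {R L : ℝ → ℤ} (S : Finset ℝ) :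
    ∀ (b : EReal) (l : ℤ), 0 < b → (∀ x ∈ S, 0 < x ∧ (x : EReal) < b) →
      IsPiecewiseAffine g {x | 0 < x ∧ (x : EReal) < b} S →
      (∃ c : ℝ, ∀ᶠ y in rightOf (0 : ℝ), g y = R 0 * y + c) →
      (∀ x ∈ S, ∃ c : ℝ, ∀ᶠ y in rightOf x, g y = R x * y + c) →
      (∀ x ∈ S, ∃ c : ℝ, ∀ᶠ y in leftOf x, g y = -L x * y + c) →
      (∃ c : ℝ, ∀ᶠ y in leftOf b, g y = -l * y + c) →
      R 0 + ∑ x ∈ S, (R x + L x) + l = 0 := by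
  have piece : ∀ (S : Finset ℝ) (a : ℝ) (b : EReal) (l : ℤ), 0 ≤ a → (a : EReal) < b →
      (∀ x ∈ S, x ≤ a) → IsPiecewiseAffine g {x | 0 < x ∧ (x : EReal) < b} S →
      (∃ c : ℝ, ∀ᶠ y in rightOf a, g y = R a * y + c) →
      (∃ c : ℝ, ∀ᶠ y in leftOf b, g y = -l * y + c) → R a + l = 0 := by
    rintro S a b l h0 hab hS hg ⟨c, hc⟩ ⟨c', hc'⟩
    obtain ⟨m, c₀, h⟩ := hg {x | a < x ∧ (x : EReal) < b}
      ⟨fun x hx y hy z hz => ⟨hx.1.trans_le hz.1,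
        (EReal.coe_le_coe_iff.2 hz.2).trans_lt hy.2⟩⟩
      fun x hx => ⟨⟨h0.trans_lt hx.1, hx.2⟩, fun h => (hS x h).not_gt hx.1⟩
    have e1 : (R a : ℝ) = m := (isOneSided_rightOf (EReal.coe_lt_top a)).slope_unique hc <|
      (eventually_rightOf hab).mono fun x hx => h x ⟨EReal.coe_lt_coe_iff.1 hx.1, hx.2⟩
    have e2 : (-l : ℝ) = m := (isOneSided_leftOf (bot_le.trans_lt hab)).slope_unique hc' <|
      (eventually_leftOf hab).mono fun x hx => h x ⟨EReal.coe_lt_coe_iff.1 hx.1, hx.2⟩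
    have : (R a : ℝ) + l = 0 := by linarith
    exact_mod_cast this
  induction S using Finset.induction_on_max with
  | empty =>
    intro b l hb _ hg h1 _ _ h4
    simpa using piece ∅ 0 b l le_rfl (by simpa using hb) (by simp) hg h1 h4
  | insert y S hy ih =>
    intro b l hb hS hg h1 h2 h3 h4
    have hyS : y ∉ S := fun h => (hy y h).false
    obtain ⟨hy0, hyb⟩ := hS y (by simp)
    have e1 := ih y (L y) (by exact_mod_cast hy0)
      (fun x hx => ⟨(hS x (by simp [hx])).1, by exact_mod_cast hy x hx⟩)
      (fun I hI hIU => hg I hI fun x hx => by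
        obtain ⟨⟨ha, hb⟩, hc⟩ := hIU x hx
        refine ⟨⟨ha, hb.trans hyb⟩, ?_⟩
        rw [Finset.mem_insert, not_or]
        exact ⟨(EReal.coe_lt_coe_iff.1 hb).ne, hc⟩)
      h1 (fun x hx => h2 x (by simp [hx])) (fun x hx => h3 x (by simp [hx])) (h3 y (by simp))
    have e2 := piece (insert y S) y b l hy0.le hyb
      (fun x hx => by
        rcases Finset.mem_insert.1 hx with rfl | hx
        exacts [le_rfl, (hy x hx).le]) hg (h2 y (by simp)) h4
    rw [Finset.sum_insert hyS]
    linarith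

variable {Γ : MetricGraph}

/-! ### Real valued piecewise linear functions and their divisors -/

/-- The coordinates, as real numbers, of the points close to `p` in the direction `d`. -/
noncomputable def realGerm (p : Γ.Point) (d : Γ.Dart) : Filter ℝ :=
  comap Real.toEReal (Γ.germ p d)

variable (Γ) in
/-- The coordinates of the interior points of the edge `e`. -/
def openEdge (e : Γ.E) : Set ℝ := {x | 0 < x ∧ (x : EReal) < Γ.len e}

theorem ordConnected_openEdge (e : Γ.E) : (Γ.openEdge e).OrdConnected :=
  ⟨fun _ hx _ hy _ hz =>
    ⟨hx.1.trans_le hz.1, (EReal.coe_le_coe_iff.2 hz.2).trans_lt hy.2⟩⟩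

theorem isOpen_openEdge (e : Γ.E) : IsOpen (Γ.openEdge e) :=
  (isOpen_Ioi (a := (0 : ℝ))).inter
    ((isOpen_Iio (a := Γ.len e)).preimage continuous_coe_real_ereal)

variable (Γ) in
/-- The coordinates, as real numbers, of the points of the closed edge `e`. For an infinite edge,
the infinite end is left out. -/
def closedEdge (e : Γ.E) : Set ℝ := {x | 0 ≤ x ∧ (x : EReal) ≤ Γ.len e}

theorem openEdge_subset_closedEdge (e : Γ.E) : Γ.openEdge e ⊆ Γ.closedEdge e :=
  fun _ hx => ⟨hx.1.le, hx.2.le⟩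

theorem edgePoint_of_mem {e : Γ.E} {x : ℝ} (hx : x ∈ Γ.openEdge e) :
    Γ.edgePoint e x = .interior e x hx.1 hx.2 := by
  have h : 0 < (x : EReal) ∧ (x : EReal) < Γ.len e := ⟨by exact_mod_cast hx.1, hx.2⟩
  simp [edgePoint, h]

theorem edgePoint_zero (e : Γ.E) : Γ.edgePoint e 0 = .vertex (Γ.src e) := by
  simp [edgePoint]

theorem edgePoint_len (e : Γ.E) : Γ.edgePoint e (Γ.len e) = .vertex (Γ.tgt e) := by
  simp [edgePoint, (Γ.len_pos e).not_ge]

theorem not_isInfinite_interior {e : Γ.E} {x : ℝ} (h0 : 0 < x) (h1 : (x : EReal) < Γ.len e) :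
    ¬ Γ.IsInfinite (.interior e x h0 h1) := by
  rintro ⟨e', _, h⟩
  cases h

theorem isInfinite_vertex_iff {v : Γ.V} :
    Γ.IsInfinite (.vertex v) ↔ ∃ e, Γ.len e = ⊤ ∧ v = Γ.tgt e := by
  simp [IsInfinite]

theorem not_isInfinite_src (e : Γ.E) : ¬ Γ.IsInfinite (.vertex (Γ.src e)) := by
  rw [isInfinite_vertex_iff]
  rintro ⟨e', h, h'⟩
  exact (Γ.infinite_end e' h).1 e h'

theorem not_isInfinite_tgt {e : Γ.E} (he : Γ.len e ≠ ⊤) :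
    ¬ Γ.IsInfinite (.vertex (Γ.tgt e)) := by
  rw [isInfinite_vertex_iff]
  rintro ⟨e', h, h'⟩
  exact he ((Γ.infinite_end e' h).2 e h' ▸ h)

theorem not_isInfinite_edgePoint {e : Γ.E} {x : ℝ} (hx : x ∈ Γ.closedEdge e) :
    ¬ Γ.IsInfinite (Γ.edgePoint e x) := by
  rcases hx.1.eq_or_lt with rfl | h0
  · rw [EReal.coe_zero, edgePoint_zero]
    exact not_isInfinite_src e
  rcases hx.2.eq_or_lt with h1 | h1
  · rw [h1, edgePoint_len]
    exact not_isInfinite_tgt (h1 ▸ EReal.coe_ne_top x)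
  · rw [edgePoint_of_mem ⟨h0, h1⟩]
    exact not_isInfinite_interior _ _

/-- A tangent direction at `p` leaves room on the underlying edge: the coordinate of `p` is not at the
end of the edge to which the direction points. -/
theorem coord_mem {p : Γ.Point} {d : Γ.Dart} (hd : d ∈ Γ.directions p) :
    if d.2 then 0 ≤ Γ.coord p d ∧ Γ.coord p d < Γ.len d.1
      else 0 < Γ.coord p d ∧ Γ.coord p d ≤ Γ.len d.1 := by
  have hpos := Γ.len_pos d.1
  cases p with
  | vertex v => cases h : d.2 <;> simp [coord, h, hpos]
  | interior e t h0 h1 =>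
    have : d.1 = e := by simpa [directions] using hd
    have h0' : (0 : EReal) < t := by exact_mod_cast h0
    cases h : d.2 <;> simp [coord, this, h0, h0.le, h1, h1.le]

theorem isOneSided_realGerm {p : Γ.Point} {d : Γ.Dart} (hd : d ∈ Γ.directions p) :
    IsOneSided (realGerm p d) := by
  have := coord_mem hd
  unfold realGerm germ
  split_ifs at this ⊢ with h
  · exact isOneSided_rightOf (this.2.trans_le le_top)
  · exact isOneSided_leftOf (bot_le.trans_lt this.1)

theorem eventually_mem_openEdge {p : Γ.Point} {d : Γ.Dart} (hd : d ∈ Γ.directions p) :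
    ∀ᶠ x in realGerm p d, x ∈ Γ.openEdge d.1 := by
  have := coord_mem hd
  unfold realGerm germ
  split_ifs at this ⊢ with h
  · exact (eventually_rightOf this.2).mono fun x hx =>
      ⟨EReal.coe_lt_coe_iff.1 (this.1.trans_lt hx.1), hx.2⟩
  · exact (eventually_leftOf this.1).mono fun x hx =>
      ⟨EReal.coe_lt_coe_iff.1 hx.1, hx.2.trans_le this.2⟩

theorem realGerm_le {p : Γ.Point} {d : Γ.Dart} {a : ℝ} (ha : Γ.coord p d = a) :
    realGerm p d ≤ 𝓝 a := by
  unfold realGerm germ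
  rw [ha]
  split_ifs
  · exact (rightOf_coe a).trans_le nhdsWithin_le_nhds
  · exact (leftOf_coe a).trans_le nhdsWithin_le_nhds

variable (Γ) in
/-- Real valued piecewise linear functions with integer slopes on the metric graph, given by the
values at the vertices and by the functions on the edges in terms of the coordinate. Infinite values
are avoided: at an infinite vertex, where a rational function may be infinite, the value is instead
copied from the other end of the edge, so that no continuity is required there. -/
structure PLFun where
  val : Γ.V → ℝ
  onEdge : Γ.E → ℝ → ℝ
  onEdge_zero : ∀ e, onEdge e 0 = val (Γ.src e)
  onEdge_len : ∀ e (l : ℝ), Γ.len e = l → onEdge e l = val (Γ.tgt e)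
  val_tgt_of_infinite : ∀ e, Γ.len e = ⊤ → val (Γ.tgt e) = val (Γ.src e)
  continuousOn : ∀ e, ContinuousOn (onEdge e) (Γ.closedEdge e)
  piecewiseAffine : ∀ e, ∃ S : Finset ℝ, IsPiecewiseAffine (onEdge e) (Γ.openEdge e) S

namespace PLFun

/-- The value of a piecewise linear function at a point. -/
def eval (f : Γ.PLFun) : Γ.Point → ℝ
  | .vertex v => f.val v
  | .interior e t _ _ => f.onEdge e t

/-- The slope of `f` at `p` in the tangent direction `d`, directed away from `p`, is `m`. -/
def HasSlope (f : Γ.PLFun) (p : Γ.Point) (d : Γ.Dart) (m : ℤ) : Prop :=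
  ∃ c : ℝ, ∀ᶠ x in realGerm p d, f.onEdge d.1 x = (if d.2 then (m : ℝ) else -m) * x + c

/-- `D = div(f)`. -/
def HasDiv (f : Γ.PLFun) (D : Γ.Divisor) : Prop :=
  ∃ slope : Γ.Point → Γ.Dart → ℤ,
    (∀ p, ∀ d ∈ Γ.directions p, f.HasSlope p d (slope p d)) ∧
      ∀ p, D p = ∑ d ∈ Γ.directions p, slope p d

instance : Sub Γ.PLFun where
  sub f g :=
    { val := fun v => f.val v - g.val v
      onEdge := fun e x => f.onEdge e x - g.onEdge e x
      onEdge_zero := fun e => by rw [f.onEdge_zero, g.onEdge_zero]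
      onEdge_len := fun e l h => by rw [f.onEdge_len e l h, g.onEdge_len e l h]
      val_tgt_of_infinite := fun e h => by
        rw [f.val_tgt_of_infinite e h, g.val_tgt_of_infinite e h]
      continuousOn := fun e => (f.continuousOn e).sub (g.continuousOn e)
      piecewiseAffine := fun e =>
        let ⟨_, hS⟩ := f.piecewiseAffine e
        let ⟨_, hT⟩ := g.piecewiseAffine e
        ⟨_, hS.sub hT⟩ }

theorem HasSlope.sub {f g : Γ.PLFun} {p : Γ.Point} {d : Γ.Dart} {m k : ℤ}
    (hf : f.HasSlope p d m) (hg : g.HasSlope p d k) : (f - g).HasSlope p d (m - k) := by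
  obtain ⟨c, hc⟩ := hf
  obtain ⟨c', hc'⟩ := hg
  refine ⟨c - c', ?_⟩
  filter_upwards [hc, hc'] with x h h'
  change f.onEdge d.1 x - g.onEdge d.1 x = _
  rw [h, h']
  split_ifs <;> push_cast <;> ring

theorem HasDiv.sub {f g : Γ.PLFun} {D D' : Γ.Divisor} (hf : f.HasDiv D) (hg : g.HasDiv D') :
    (f - g).HasDiv (D - D') := by
  obtain ⟨s, hs, hD⟩ := hf
  obtain ⟨s', hs', hD'⟩ := hg
  exact ⟨fun p d => s p d - s' p d, fun p d hd => (hs p d hd).sub (hs' p d hd),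
    fun p => by simp [hD, hD', Finset.sum_sub_distrib]⟩

/-- The maximum of a piecewise linear function and a constant. -/
def maxConst (f : Γ.PLFun) (t : ℝ) : Γ.PLFun where
  val v := max (f.val v) t
  onEdge e x := max (f.onEdge e x) t
  onEdge_zero e := by rw [f.onEdge_zero]
  onEdge_len e l h := by rw [f.onEdge_len e l h]
  val_tgt_of_infinite e h := by rw [f.val_tgt_of_infinite e h]
  continuousOn e := (f.continuousOn e).sup continuousOn_const
  piecewiseAffine e :=
    let ⟨_, hS⟩ := f.piecewiseAffine e
    hS.max_const (ordConnected_openEdge e) t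

open Classical in
theorem HasSlope.maxConst {f : Γ.PLFun} {p : Γ.Point} {d : Γ.Dart} {m : ℤ}
    (hf : f.HasSlope p d m) (hd : d ∈ Γ.directions p) (t : ℝ) :
    (f.maxConst t).HasSlope p d (if ∀ᶠ x in realGerm p d, t ≤ f.onEdge d.1 x then m else 0) := by
  obtain ⟨c, hc⟩ := hf
  by_cases h : ∀ᶠ x in realGerm p d, t ≤ f.onEdge d.1 x
  · refine ⟨c, ?_⟩
    filter_upwards [h, hc] with x h1 h2
    rw [if_pos h, ← h2]
    exact max_eq_left h1
  · refine ⟨t, ?_⟩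
    filter_upwards [((isOneSided_realGerm hd).le_or_le hc t).resolve_left h] with x hx
    rw [if_neg h]
    exact (max_eq_right hx).trans (by simp)

/-! ### The divisor of a piecewise linear function has finite support and degree zero -/

theorem sum_directions_interior {M : Type*} [AddCommMonoid M] {e : Γ.E} {t : ℝ} (h0 : 0 < t)
    (h1 : (t : EReal) < Γ.len e) (s : Γ.Dart → M) :
    ∑ d ∈ Γ.directions (.interior e t h0 h1), s d = s (e, true) + s (e, false) := by
  classical
  have : Γ.directions (.interior e t h0 h1) = {(e, true), (e, false)} := by
    ext ⟨e', b⟩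
    cases b <;> simp [directions]
  rw [this, Finset.sum_pair (by simp)]

theorem mem_directions_interior {e : Γ.E} {t : ℝ} {h0 : 0 < t}
    {h1 : (t : EReal) < Γ.len e} {d : Γ.Dart} :
    d ∈ Γ.directions (.interior e t h0 h1) ↔ d.1 = e := by
  simp [directions]

theorem mem_directions_vertex {v : Γ.V} {d : Γ.Dart} :
    d ∈ Γ.directions (.vertex v) ↔ Dart.start d = v := by
  simp [directions]

/-- The slope in a given direction is unique. -/
theorem HasSlope.eq_of_affine {f : Γ.PLFun} {p : Γ.Point} {d : Γ.Dart} {m : ℤ}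
    (h : f.HasSlope p d m) (hd : d ∈ Γ.directions p) {k : ℤ} {c : ℝ}
    (hk : ∀ᶠ x in realGerm p d, f.onEdge d.1 x = k * x + c) : m = if d.2 then k else -k := by
  obtain ⟨c', hc'⟩ := h
  have := (isOneSided_realGerm hd).slope_unique hc' hk
  split_ifs at this ⊢
  · exact_mod_cast this
  · rw [neg_eq_iff_eq_neg] at this
    exact_mod_cast this

theorem sum_slopes_eq_zero_of_notMem {f : Γ.PLFun} {slope : Γ.Point → Γ.Dart → ℤ}
    (h : ∀ p, ∀ d ∈ Γ.directions p, f.HasSlope p d (slope p d)) {e : Γ.E} {S : Finset ℝ}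
    (hS : IsPiecewiseAffine (f.onEdge e) (Γ.openEdge e) S) {t : ℝ} (ht : t ∉ S)
    (h0 : 0 < t) (h1 : (t : EReal) < Γ.len e) :
    ∑ d ∈ Γ.directions (.interior e t h0 h1), slope (.interior e t h0 h1) d = 0 := by
  have hopen : IsOpen (Γ.openEdge e \ S) := (isOpen_openEdge e).sdiff S.finite_toSet.isClosed
  obtain ⟨ε, hε, hsub⟩ := Metric.isOpen_iff.1 hopen t ⟨⟨h0, h1⟩, ht⟩
  rw [Real.ball_eq_Ioo] at hsub
  obtain ⟨m, c, hm⟩ := hS _ ordConnected_Ioo fun x hx => hsub hx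
  have key : ∀ b, slope (.interior e t h0 h1) (e, b) = if b then m else -m := fun b => by
    have hd : (e, b) ∈ Γ.directions (.interior e t h0 h1) := by simp [directions]
    refine (h _ _ hd).eq_of_affine hd (c := c) ?_
    have hI : Ioo (t - ε) (t + ε) ∈ 𝓝 t := Ioo_mem_nhds (by linarith) (by linarith)
    filter_upwards [realGerm_le (p := .interior e t h0 h1) (d := (e, b)) rfl hI] with x hx
    exact hm x hx
  rw [sum_directions_interior, key, key]
  simp

/-- A choice of coordinates of interior points of the edge `e` off which `f` is affine on `e`. -/
noncomputable def breakPoints (f : Γ.PLFun) (e : Γ.E) : Finset ℝ := by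
  classical exact (f.piecewiseAffine e).choose.filter (· ∈ Γ.openEdge e)

theorem breakPoints_spec (f : Γ.PLFun) (e : Γ.E) :
    (∀ x ∈ f.breakPoints e, x ∈ Γ.openEdge e) ∧
      IsPiecewiseAffine (f.onEdge e) (Γ.openEdge e) (f.breakPoints e) := by
  classical
  refine ⟨fun x hx => by simpa using (Finset.mem_filter.1 hx).2, fun I hI hIU => ?_⟩
  exact (f.piecewiseAffine e).choose_spec I hI fun x hx =>
    ⟨(hIU x hx).1, fun h => (hIU x hx).2 (Finset.mem_filter.2 ⟨h, (hIU x hx).1⟩)⟩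

open Classical in
/-- The vertices, and the break points of `f`. -/
noncomputable def special (f : Γ.PLFun) : Finset Γ.Point :=
  Finset.univ.image Point.vertex ∪
    Finset.univ.biUnion fun e => (f.breakPoints e).image fun x : ℝ => Γ.edgePoint e x

theorem mem_special_of_ne_zero {f : Γ.PLFun} {slope : Γ.Point → Γ.Dart → ℤ}
    (h : ∀ p, ∀ d ∈ Γ.directions p, f.HasSlope p d (slope p d)) {p : Γ.Point}
    (hp : ∑ d ∈ Γ.directions p, slope p d ≠ 0) : p ∈ f.special := by
  classical
  cases p with
  | vertex v => simp [special]
  | interior e t h0 h1 =>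
    by_contra hn
    refine hp (sum_slopes_eq_zero_of_notMem h (f.breakPoints_spec e).2 (fun ht => hn ?_) h0 h1)
    refine Finset.mem_union_right _ (Finset.mem_biUnion.2
      ⟨e, by simp, Finset.mem_image.2 ⟨t, ht, ?_⟩⟩)
    exact edgePoint_of_mem ⟨h0, h1⟩

theorem exists_divisor {f : Γ.PLFun} {slope : Γ.Point → Γ.Dart → ℤ}
    (h : ∀ p, ∀ d ∈ Γ.directions p, f.HasSlope p d (slope p d)) :
    ∃ D : Γ.Divisor, ∀ p, D p = ∑ d ∈ Γ.directions p, slope p d := by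
  classical
  exact ⟨Finsupp.onFinset f.special (fun p => ∑ d ∈ Γ.directions p, slope p d)
    fun p hp => mem_special_of_ne_zero h hp, fun p => rfl⟩

theorem sum_special {f : Γ.PLFun} (F : Γ.Point → ℤ) :
    ∑ p ∈ f.special, F p =
      ∑ v, F (.vertex v) + ∑ e, ∑ x ∈ f.breakPoints e, F (Γ.edgePoint e x) := by
  classical
  have hpt : ∀ e, ∀ x ∈ f.breakPoints e, ∃ h0 h1, Γ.edgePoint e x = .interior e x h0 h1 :=
    fun e x hx => ⟨_, _, edgePoint_of_mem ((f.breakPoints_spec e).1 x hx)⟩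
  rw [special, Finset.sum_union, Finset.sum_image, Finset.sum_biUnion]
  · congr 1
    refine Finset.sum_congr rfl fun e _ => Finset.sum_image fun x hx y hy hxy => ?_
    obtain ⟨_, _, h⟩ := hpt e x hx
    obtain ⟨_, _, h'⟩ := hpt e y hy
    simp only [h, h'] at hxy
    cases hxy
    rfl
  · intro e _ e' _ hne
    refine Finset.disjoint_left.2 fun p hp hp' => hne ?_
    obtain ⟨x, hx, rfl⟩ := Finset.mem_image.1 hp
    obtain ⟨y, hy, hxy⟩ := Finset.mem_image.1 hp'
    obtain ⟨_, _, h⟩ := hpt e x hx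
    obtain ⟨_, _, h'⟩ := hpt e' y hy
    simp only [h, h'] at hxy
    cases hxy
    rfl
  · intro v _ w _ h
    cases h
    rfl
  · refine Finset.disjoint_left.2 fun p hp hp' => ?_
    obtain ⟨v, _, rfl⟩ := Finset.mem_image.1 hp
    obtain ⟨e, _, hp'⟩ := Finset.mem_biUnion.1 hp'
    obtain ⟨x, hx, hxy⟩ := Finset.mem_image.1 hp'
    obtain ⟨_, _, h⟩ := hpt e x hx
    simp only [h] at hxy
    cases hxy

theorem HasDiv.deg_eq_zero {f : Γ.PLFun} {D : Γ.Divisor} (hD : f.HasDiv D) : Γ.deg D = 0 := by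
  classical
  obtain ⟨s, hs, hD⟩ := hD
  have h1 : Γ.deg D = ∑ p ∈ f.special, D p :=
    Finsupp.sum_of_support_subset _
      (fun p hp => mem_special_of_ne_zero hs (hD p ▸ Finsupp.mem_support_iff.1 hp)) _ (by simp)
  -- Group the slopes at the vertices by edges.
  have h2 : ∑ v, D (.vertex v) =
      ∑ e, (s (.vertex (Γ.src e)) (e, true) + s (.vertex (Γ.tgt e)) (e, false)) := by
    calc ∑ v, D (.vertex v)
        = ∑ v, ∑ d : Γ.Dart with Dart.start d = v, s (.vertex (Dart.start d)) d := by
          refine Finset.sum_congr rfl fun v _ => ?_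
          rw [hD, show Γ.directions (.vertex v) = Finset.univ.filter (fun d => Dart.start d = v) by
            ext; simp [directions]]
          refine Finset.sum_congr rfl fun d hd => ?_
          rw [(Finset.mem_filter.1 hd).2]
      _ = ∑ d : Γ.Dart, s (.vertex (Dart.start d)) d :=
          Finset.sum_fiberwise _ _ _
      _ = _ := by
          rw [Fintype.sum_prod_type]
          simp [Dart.start]
  rw [h1, sum_special, h2, ← Finset.sum_add_distrib]
  refine Finset.sum_eq_zero fun e _ => ?_
  obtain ⟨hb, hg⟩ := f.breakPoints_spec e
  set R : ℝ → ℤ := fun x => s (Γ.edgePoint e x) (e, true)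
  set L : ℝ → ℤ := fun x => s (Γ.edgePoint e x) (e, false)
  have key := hg.sum_slopes_eq_zero (R := R) (L := L) _ (Γ.len e)
    (s (.vertex (Γ.tgt e)) (e, false)) (Γ.len_pos e) hb
  rw [show R 0 = s (.vertex (Γ.src e)) (e, true) by
    simp only [R, EReal.coe_zero, edgePoint_zero]] at key
  have hsum : ∑ x ∈ f.breakPoints e, D (Γ.edgePoint e x) =
      ∑ x ∈ f.breakPoints e, (R x + L x) :=
    Finset.sum_congr rfl fun x hx => by
      simp only [R, L, edgePoint_of_mem (hb x hx), hD, sum_directions_interior]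
  rw [hsum, add_right_comm]
  refine key ?_ ?_ ?_ ?_
  · simpa [HasSlope, realGerm, germ, rightOf, coord] using
      hs (.vertex (Γ.src e)) (e, true) (mem_directions_vertex.2 (by simp [Dart.start]))
  · intro x hx
    have := hs (Γ.edgePoint e x) (e, true)
      (by rw [edgePoint_of_mem (hb x hx)]; simp [directions])
    simpa [R, HasSlope, realGerm, germ, rightOf, coord, edgePoint_of_mem (hb x hx)] using this
  · intro x hx
    have := hs (Γ.edgePoint e x) (e, false)
      (by rw [edgePoint_of_mem (hb x hx)]; simp [directions])
    simpa [L, HasSlope, realGerm, germ, leftOf, coord, edgePoint_of_mem (hb x hx)] using this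
  · simpa [HasSlope, realGerm, germ, leftOf, coord] using
      hs (.vertex (Γ.tgt e)) (e, false) (mem_directions_vertex.2 (by simp [Dart.start]))

/-! ### Truncating a piecewise linear function -/

theorem exists_coord {p : Γ.Point} {d : Γ.Dart} (hp : ¬ Γ.IsInfinite p)
    (hd : d ∈ Γ.directions p) (f : Γ.PLFun) :
    ∃ a : ℝ, Γ.coord p d = a ∧ a ∈ Γ.closedEdge d.1 ∧ f.onEdge d.1 a = f.eval p := by
  obtain ⟨e, b⟩ := d
  cases p with
  | vertex v =>
    obtain rfl := mem_directions_vertex.1 hd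
    cases b with
    | true => exact ⟨0, by simp [coord], ⟨le_rfl, (Γ.len_pos e).le⟩, f.onEdge_zero e⟩
    | false =>
      have htop : Γ.len e ≠ ⊤ := fun h => hp ⟨e, h, rfl⟩
      have hl := EReal.coe_toReal htop (ne_bot_of_gt (Γ.len_pos e))
      refine ⟨(Γ.len e).toReal, by simp [coord, hl], ⟨?_, hl.le⟩, f.onEdge_len e _ hl.symm⟩
      exact EReal.toReal_nonneg (Γ.len_pos e).le
  | interior e' t h0 h1 =>
    obtain rfl : e = e' := mem_directions_interior.1 hd
    exact ⟨t, rfl, ⟨h0.le, h1.le⟩, rfl⟩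

theorem tendsto_onEdge {p : Γ.Point} {d : Γ.Dart} (hp : ¬ Γ.IsInfinite p)
    (hd : d ∈ Γ.directions p) (f : Γ.PLFun) :
    Tendsto (f.onEdge d.1) (realGerm p d) (𝓝 (f.eval p)) := by
  obtain ⟨a, ha, hmem, heval⟩ := exists_coord hp hd f
  rw [← heval]
  refine (f.continuousOn d.1 a hmem).mono_left (le_inf (realGerm_le ha) (le_principal_iff.2 ?_))
  exact (eventually_mem_openEdge hd).mono fun x hx => openEdge_subset_closedEdge _ hx

/-- Close to `p` in the direction `d`, the value of `f` is `f p + m * r` at distance `r`. -/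
theorem HasSlope.eventually_eq {f : Γ.PLFun} {p : Γ.Point} {d : Γ.Dart} {m : ℤ}
    (h : f.HasSlope p d m) (hp : ¬ Γ.IsInfinite p) (hd : d ∈ Γ.directions p) :
    ∀ᶠ x in realGerm p d, ∃ r : ℝ, 0 < r ∧ f.onEdge d.1 x = f.eval p + m * r := by
  obtain ⟨a, ha, -, -⟩ := exists_coord hp hd f
  obtain ⟨c, hc⟩ := h
  have := (isOneSided_realGerm hd).1
  have hlim : f.eval p = (if d.2 then (m : ℝ) else -m) * a + c := by
    refine tendsto_nhds_unique ((tendsto_onEdge hp hd f).congr' hc) ?_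
    exact ((continuous_const.mul continuous_id).add continuous_const).continuousAt.mono_left
      (realGerm_le ha)
  have hside : ∀ᶠ x in realGerm p d, if d.2 then a < x else x < a := by
    unfold realGerm germ
    rw [ha]
    split_ifs
    · exact (eventually_rightOf (EReal.coe_lt_top a)).mono fun x hx => EReal.coe_lt_coe_iff.1 hx.1
    · exact (eventually_leftOf (EReal.bot_lt_coe a)).mono fun x hx => EReal.coe_lt_coe_iff.1 hx.2
  filter_upwards [hc, hside] with x hx hx'
  rw [hx, hlim]
  split_ifs at hx' ⊢
  · exact ⟨x - a, sub_pos.2 hx', by ring⟩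
  · exact ⟨a - x, sub_pos.2 hx', by ring⟩

open Classical in
/-- How the slopes of `max f t` at a point `p` compare with those of `f`: they agree if `f p > t`,
they vanish if `f p < t`, and they are the positive parts if `f p = t`. -/
theorem slope_maxConst_cases {f : Γ.PLFun} {slope : Γ.Point → Γ.Dart → ℤ}
    (h : ∀ p, ∀ d ∈ Γ.directions p, f.HasSlope p d (slope p d)) (t : ℝ) {p : Γ.Point}
    (hp : ¬ Γ.IsInfinite p) {d : Γ.Dart} (hd : d ∈ Γ.directions p) :
    (if ∀ᶠ x in realGerm p d, t ≤ f.onEdge d.1 x then slope p d else 0) =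
      if t < f.eval p then slope p d else if f.eval p < t then 0 else max (slope p d) 0 := by
  have hne := (isOneSided_realGerm hd).1
  have not_of_lt : (∀ᶠ x in realGerm p d, f.onEdge d.1 x < t) →
      ¬ ∀ᶠ x in realGerm p d, t ≤ f.onEdge d.1 x := fun h1 h2 => by
    obtain ⟨x, h1, h2⟩ := (h1.and h2).exists
    exact h1.not_ge h2
  have hlim := tendsto_onEdge hp hd f
  split_ifs with h1 h2 h3 h2 h3
  · rfl
  · exact absurd h1 (not_of_lt (hlim.eventually (gt_mem_nhds h3)))
  · obtain ⟨x, hx, r, hr, hxr⟩ := (h1.and ((h p d hd).eventually_eq hp hd)).exists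
    have hev : f.eval p = t := le_antisymm (not_lt.1 h2) (not_lt.1 h3)
    rw [max_eq_left]
    by_contra! hneg
    have : (slope p d : ℝ) * r < 0 := mul_neg_of_neg_of_pos (by exact_mod_cast hneg) hr
    linarith
  · exact absurd ((hlim.eventually (lt_mem_nhds h2)).mono fun x hx => hx.le) h1
  · rfl
  · rw [max_eq_right]
    by_contra! hpos
    refine h1 (((h p d hd).eventually_eq hp hd).mono fun x ⟨r, hr, hx⟩ => ?_)
    have : 0 < (slope p d : ℝ) * r := mul_pos (by exact_mod_cast hpos) hr
    linarith

/-- If `E` and `E' = E + div(f)` are effective, then so is `G = E + div(max f t)`: the chips that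
move from `E` to `E'` are stopped at the level `t`. Where `f` takes the value `t`, the divisor `G`
dominates both `E` and `E'`, and it has a chip where `f` grows in some direction from there. -/
theorem exists_effective_maxConst {f : Γ.PLFun} {E E' : Γ.Divisor} (hE : 0 ≤ E) (hE' : 0 ≤ E')
    (hf : f.HasDiv (E' - E)) (t : ℝ) :
    ∃ G : Γ.Divisor, 0 ≤ G ∧ (f.maxConst t).HasDiv (G - E) ∧
      (∀ p, ¬ Γ.IsInfinite p → f.eval p = t → E p ≤ G p ∧ E' p ≤ G p) ∧
      ∀ p, ¬ Γ.IsInfinite p → f.eval p = t → G p = 0 → ∀ d ∈ Γ.directions p,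
        ∀ᶠ x in realGerm p d, f.onEdge d.1 x ≤ t := by
  classical
  obtain ⟨s, hs, hdiv⟩ := hf
  have hs' : ∀ p, ∀ d ∈ Γ.directions p, (f.maxConst t).HasSlope p d
      (if ∀ᶠ x in realGerm p d, t ≤ f.onEdge d.1 x then s p d else 0) :=
    fun p d hd => (hs p d hd).maxConst hd t
  obtain ⟨D, hD⟩ := exists_divisor hs'
  have hE'p : ∀ p, E' p = E p + ∑ d ∈ Γ.directions p, s p d := fun p => by
    rw [← hdiv p, Finsupp.sub_apply]
    ring
  have hlevel : ∀ p, ¬ Γ.IsInfinite p → f.eval p = t →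
      D p = ∑ d ∈ Γ.directions p, max (s p d) 0 := fun p hp ht => by
    rw [hD]
    refine Finset.sum_congr rfl fun d hd => ?_
    rw [slope_maxConst_cases hs t hp hd, if_neg (by simp [ht]), if_neg (by simp [ht])]
  have hD0 : ∀ p, ¬ Γ.IsInfinite p → f.eval p = t → 0 ≤ D p := fun p hp ht => by
    rw [hlevel p hp ht]
    exact Finset.sum_nonneg fun d _ => le_max_right _ _
  have hD1 : ∀ p, ¬ Γ.IsInfinite p → f.eval p = t → E' p ≤ E p + D p := fun p hp ht => by
    rw [hE'p, hlevel p hp ht]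
    exact add_le_add_right (Finset.sum_le_sum fun d _ => le_max_left _ _) _
  refine ⟨E + D, fun p => ?_, ⟨_, hs', fun p => by simp [hD]⟩, fun p hp ht => ?_, ?_⟩
  · rw [Finsupp.add_apply, Finsupp.zero_apply]
    have hEp : 0 ≤ E p := hE p
    have hE'p0 : 0 ≤ E' p := hE' p
    by_cases hp : Γ.IsInfinite p
    · -- At an infinite vertex there is only one direction.
      obtain ⟨e, he, rfl⟩ := hp
      have hdir : Γ.directions (.vertex (Γ.tgt e)) = {(e, false)} := by
        ext ⟨e', b⟩
        rw [mem_directions_vertex, Finset.mem_singleton, Prod.mk.injEq]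
        cases b with
        | true => simpa [Dart.start] using (Γ.infinite_end e he).1 e'
        | false =>
          simp only [Dart.start, Bool.false_eq_true, if_false, and_true]
          exact ⟨(Γ.infinite_end e he).2 e', fun h => h ▸ rfl⟩
      have h1 := hE'p (.vertex (Γ.tgt e))
      rw [hdir, Finset.sum_singleton] at h1
      rw [hD, hdir, Finset.sum_singleton]
      split_ifs <;> omega
    · rcases lt_trichotomy t (f.eval p) with h | h | h
      · have : D p = ∑ d ∈ Γ.directions p, s p d := by
          rw [hD]
          refine Finset.sum_congr rfl fun d hd => ?_
          rw [slope_maxConst_cases hs t hp hd, if_pos h]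
        have := hE'p p
        omega
      · have := hD0 p hp h.symm
        omega
      · have : D p = 0 := by
          rw [hD]
          refine Finset.sum_eq_zero fun d hd => ?_
          rw [slope_maxConst_cases hs t hp hd, if_neg h.le.not_gt, if_pos h]
        omega
  · rw [Finsupp.add_apply]
    exact ⟨le_add_of_nonneg_right (hD0 p hp ht), hD1 p hp ht⟩
  · intro p hp ht h0 d hd
    have hEp : 0 ≤ E p := hE p
    have hDp := hD0 p hp ht
    rw [Finsupp.add_apply] at h0
    have hz : D p = 0 := by omega
    rw [hlevel p hp ht, Finset.sum_eq_zero_iff_of_nonneg fun d _ => le_max_right _ _] at hz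
    have hsd : s p d ≤ 0 := max_eq_right_iff.1 (hz d hd)
    filter_upwards [(hs p d hd).eventually_eq hp hd] with x ⟨r, hr, hx⟩
    have : (s p d : ℝ) * r ≤ 0 := mul_nonpos_of_nonpos_of_nonneg (by exact_mod_cast hsd) hr.le
    linarith

/-- An edge whose ends lie on different sides of the level `t` carries a chip of a divisor that has
chips wherever `f` grows from the level `t`: otherwise the set where `f ≤ t` would be open and closed
in this edge. -/
theorem exists_chip_of_separated {f : Γ.PLFun} {t : ℝ} {G : Γ.Divisor} (hG : 0 ≤ G)
    (h : ∀ p, ¬ Γ.IsInfinite p → f.eval p = t → G p = 0 → ∀ d ∈ Γ.directions p,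
      ∀ᶠ x in realGerm p d, f.onEdge d.1 x ≤ t) {e : Γ.E}
    (hsrc : f.val (Γ.src e) ≠ t) (htgt : f.val (Γ.tgt e) ≠ t)
    (he : ¬ (f.val (Γ.src e) < t ↔ f.val (Γ.tgt e) < t)) :
    ∃ (x : ℝ) (h0 : 0 < x) (h1 : (x : EReal) < Γ.len e), 1 ≤ G (.interior e x h0 h1) := by
  by_contra! hno
  have htop : Γ.len e ≠ ⊤ := fun hinf => he (by rw [f.val_tgt_of_infinite e hinf])
  obtain ⟨l, hl⟩ : ∃ l : ℝ, Γ.len e = l :=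
    ⟨_, (EReal.coe_toReal htop (ne_bot_of_gt (Γ.len_pos e))).symm⟩
  have hl0 : 0 < l := by
    have := Γ.len_pos e
    rw [hl] at this
    exact_mod_cast this
  have hcont : ContinuousOn (f.onEdge e) (Icc 0 l) := by
    refine (f.continuousOn e).mono fun x hx => ⟨hx.1, ?_⟩
    rw [hl]
    exact_mod_cast hx.2
  have hf0 := f.onEdge_zero e
  have hfl := f.onEdge_len e l hl
  -- Near a point of the edge where `f ≤ t`, still `f ≤ t`.
  have hlow : ∀ x ∈ Icc 0 l, f.onEdge e x ≤ t → ∀ᶠ y in 𝓝[Icc 0 l] x, f.onEdge e y ≤ t := by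
    intro x hx hxt
    rcases hxt.lt_or_eq with hlt | heq
    · exact ((hcont x hx).eventually (gt_mem_nhds hlt)).mono fun y hy => hy.le
    · have hx0 : 0 < x := hx.1.lt_of_ne fun h0 => hsrc (by rw [← hf0, h0, heq])
      have hxl : x < l := hx.2.lt_of_ne fun h1 => htgt (by rw [← hfl, ← h1, heq])
      have hxl' : (x : EReal) < Γ.len e := by
        rw [hl]
        exact_mod_cast hxl
      have hchip : G (.interior e x hx0 hxl') = 0 := by
        have h1 := hno x hx0 hxl'
        have h2 : 0 ≤ G (.interior e x hx0 hxl') := hG _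
        omega
      have hdir := h _ (not_isInfinite_interior hx0 hxl') heq hchip
      have hr : ∀ᶠ y in 𝓝[>] x, f.onEdge e y ≤ t := by
        rw [← rightOf_coe]
        exact hdir (e, true) (mem_directions_interior.2 rfl)
      have hleft : ∀ᶠ y in 𝓝[<] x, f.onEdge e y ≤ t := by
        rw [← leftOf_coe]
        exact hdir (e, false) (mem_directions_interior.2 rfl)
      refine eventually_nhdsWithin_of_eventually_nhds ?_
      rw [← nhdsNE_sup_pure, ← nhdsLT_sup_nhdsGT]
      exact ⟨⟨hleft, hr⟩, hxt⟩
  have hopen : IsOpen {x : Icc (0 : ℝ) l | f.onEdge e x ≤ t} := by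
    rw [isOpen_iff_mem_nhds]
    intro x hx
    have := hlow x x.2 hx
    rw [nhdsWithin_eq_map_subtype_coe x.2] at this
    exact this
  have hclosed : IsClosed {x : Icc (0 : ℝ) l | f.onEdge e x ≤ t} :=
    isClosed_le (continuousOn_iff_continuous_domRestrict.1 hcont) continuous_const
  have : PreconnectedSpace (Icc (0 : ℝ) l) := Subtype.preconnectedSpace isPreconnected_Icc
  have h0mem : (0 : ℝ) ∈ Icc 0 l := ⟨le_rfl, hl0.le⟩
  have hlmem : l ∈ Icc 0 l := ⟨hl0.le, le_rfl⟩
  have hiff : f.onEdge e 0 ≤ t ↔ f.onEdge e l ≤ t := by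
    rcases isClopen_iff.1 ⟨hclosed, hopen⟩ with hA | hA
    · exact iff_of_false (fun h => (Set.ext_iff.1 hA ⟨0, h0mem⟩).1 h)
        fun h => (Set.ext_iff.1 hA ⟨l, hlmem⟩).1 h
    · exact iff_of_true ((Set.ext_iff.1 hA ⟨0, h0mem⟩).2 trivial)
        ((Set.ext_iff.1 hA ⟨l, hlmem⟩).2 trivial)
  rw [hf0, hfl] at hiff
  exact he ⟨fun h => (hiff.1 h.le).lt_of_ne htgt, fun h => (hiff.2 h.le).lt_of_ne hsrc⟩

end PLFun

/-! ### Divisors of positive rank -/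

open Classical in
/-- A rational function can be replaced by a real valued one with the same divisor: only its values at
the infinite vertices have to be changed, and these do not affect the slopes. -/
theorem IsRational.exists_plFun {f : Γ.Point → EReal} (hf : Γ.IsRational f) {D : Γ.Divisor}
    (hD : Γ.IsDivisorOf D f) : ∃ g : Γ.PLFun, g.HasDiv D := by
  have hval : ∀ v, ¬ Γ.IsInfinite (.vertex v) → ¬ ∃ e, Γ.len e = ⊤ ∧ v = Γ.tgt e :=
    fun v hv => mt isInfinite_vertex_iff.2 hv
  refine ⟨
    { val := fun v =>
        if h : ∃ e, Γ.len e = ⊤ ∧ v = Γ.tgt e then (f (.vertex (Γ.src h.choose))).toReal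
        else (f (.vertex v)).toReal
      onEdge := fun e x => (f (Γ.edgePoint e x)).toReal
      onEdge_zero := fun e => by
        rw [dif_neg (hval _ (not_isInfinite_src e)), EReal.coe_zero, edgePoint_zero]
      onEdge_len := fun e l hl => by
        rw [dif_neg (hval _ (not_isInfinite_tgt (hl ▸ EReal.coe_ne_top l))), ← hl, edgePoint_len]
      val_tgt_of_infinite := fun e he => by
        have h : ∃ e', Γ.len e' = ⊤ ∧ Γ.tgt e = Γ.tgt e' := ⟨e, he, rfl⟩
        rw [dif_pos h, dif_neg (hval _ (not_isInfinite_src e)),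
          (Γ.infinite_end e he).2 _ h.choose_spec.2.symm]
      continuousOn := fun e x hx => by
        have h1 := hf.finite _ (not_isInfinite_edgePoint hx)
        have h2 : ContinuousWithinAt (fun y : ℝ => f (Γ.edgePoint e y)) (Γ.closedEdge e) x :=
          (hf.continuous e x ⟨by exact_mod_cast hx.1, hx.2⟩).comp
            (f := Real.toEReal) continuous_coe_real_ereal.continuousWithinAt
            fun y hy => ⟨by exact_mod_cast hy.1, hy.2⟩
        exact (EReal.tendsto_toReal h1.1 h1.2).comp h2
      piecewiseAffine := fun e => by
        obtain ⟨S, hS⟩ := hf.piecewise_linear e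
        refine ⟨S, fun I hI hIU => ?_⟩
        obtain ⟨m, c, h⟩ := hS I hI fun t ht => ⟨(hIU t ht).1.1, (hIU t ht).1.2, (hIU t ht).2⟩
        exact ⟨m, c, fun t ht => by simp only [h t ht, EReal.toReal_coe]⟩ }, ?_⟩
  obtain ⟨s, hs, hdiv⟩ := hD
  refine ⟨s, fun p d hd => ?_, hdiv⟩
  obtain ⟨c, hc⟩ := hs p d hd
  refine ⟨c, (hc.comap Real.toEReal).mono fun x hx => ?_⟩
  change (f (Γ.edgePoint d.1 x)).toReal = _
  rw [hx, EReal.toReal_coe, EReal.toReal_coe]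

theorem deg_single (p : Γ.Point) (a : ℤ) : Γ.deg (Finsupp.single p a) = a :=
  Finsupp.sum_single_index rfl

theorem deg_sub (D D' : Γ.Divisor) : Γ.deg (D - D') = Γ.deg D - Γ.deg D' :=
  Finsupp.sum_sub_index fun _ _ _ => rfl

theorem card_le_deg {G : Γ.Divisor} (hG : 0 ≤ G) (T : Finset Γ.Point)
    (hT : ∀ p ∈ T, 1 ≤ G p) : (T.card : ℤ) ≤ Γ.deg G := by
  have hsub : T ⊆ G.support := fun p hp => by
    have := hT p hp
    rw [Finsupp.mem_support_iff]
    omega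
  calc (T.card : ℤ) = ∑ p ∈ T, 1 := by simp
    _ ≤ ∑ p ∈ T, G p := Finset.sum_le_sum hT
    _ ≤ ∑ p ∈ G.support, G p := Finset.sum_le_sum_of_subset_of_nonneg hsub fun p _ _ => hG p

/-- A divisor of rank `1` is equivalent to effective divisors through every point. -/
theorem exists_effective_of_rank_eq_one {D : Γ.Divisor} (hD : Γ.rank D = 1) (p : Γ.Point) :
    ∃ E : Γ.Divisor, 0 ≤ E ∧ 1 ≤ E p ∧ ∃ f : Γ.PLFun, f.HasDiv (E - D) := by
  unfold rank at hD
  split_ifs at hD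
  set R : Set ℕ := {r : ℕ | ∀ D' : Γ.Divisor, 0 ≤ D' → Γ.deg D' = r →
    (Γ.linearSystem (D - D')).Nonempty}
  have hsup : sSup R = 1 := by exact_mod_cast hD
  have hmem : 1 ∈ R := by
    have hbdd : BddAbove R := by
      by_contra h
      rw [Nat.sSup_of_not_bddAbove h] at hsup
      omega
    have hne : R.Nonempty := by
      by_contra h
      rw [Set.not_nonempty_iff_eq_empty.1 h, csSup_empty] at hsup
      exact absurd hsup (by simp)
    exact hsup ▸ Nat.sSup_mem hne hbdd
  have hs : (0 : Γ.Divisor) ≤ Finsupp.single p 1 := Finsupp.single_nonneg.2 zero_le_one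
  obtain ⟨E, hE, f, hf, hdiv⟩ := hmem (Finsupp.single p 1) hs (by simp [deg_single])
  obtain ⟨g, hg⟩ := hf.exists_plFun hdiv
  refine ⟨E + Finsupp.single p 1, add_nonneg hE hs, ?_, g, ?_⟩
  · have : 0 ≤ E p := hE p
    simpa using this
  · convert hg using 1
    abel

/-! ### Edge cuts bound the gonality -/

open Classical in
variable (Γ) in
/-- The edges with exactly one end in the set `s` of vertices. -/
noncomputable def boundary (s : Set Γ.V) : Finset Γ.E :=
  Finset.univ.filter fun e => ¬ (Γ.src e ∈ s ↔ Γ.tgt e ∈ s)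

theorem mem_boundary {s : Set Γ.V} {e : Γ.E} :
    e ∈ Γ.boundary s ↔ ¬ (Γ.src e ∈ s ↔ Γ.tgt e ∈ s) := by
  simp [boundary]

/-- If `E` and `E + div(f)` are effective and `f` has different values at two vertices, then for a
level `t` between these values the vertices with `f < t` define an edge cut separating the two, and
each edge of this cut carries a chip of the effective divisor `E + div(max f t)`. -/
theorem le_deg_of_val_lt {f : Γ.PLFun} {E E' : Γ.Divisor} (hE : 0 ≤ E) (hE' : 0 ≤ E')
    (hf : f.HasDiv (E' - E)) {a b : Γ.V} (hab : f.val a < f.val b) {k : ℕ}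
    (hk : ∀ s : Set Γ.V, a ∈ s → b ∉ s → k ≤ (Γ.boundary s).card) : (k : ℤ) ≤ Γ.deg E := by
  classical
  obtain ⟨t, ht, htval⟩ := (Ioo_infinite hab).exists_notMem_finite (finite_range f.val)
  have hval : ∀ v, f.val v ≠ t := fun v h => htval ⟨v, h⟩
  obtain ⟨G, hG, hdiv, -, hchip⟩ := PLFun.exists_effective_maxConst hE hE' hf t
  set s : Set Γ.V := {v | f.val v < t}
  have hex : ∀ e : Γ.E, ∃ p, e ∈ Γ.boundary s →
      1 ≤ G p ∧ ∃ x h0 h1, p = .interior e x h0 h1 := fun e => by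
    by_cases he : e ∈ Γ.boundary s
    · obtain ⟨x, h0, h1, h⟩ :=
        PLFun.exists_chip_of_separated hG hchip (hval _) (hval _) (mem_boundary.1 he)
      exact ⟨_, fun _ => ⟨h, x, h0, h1, rfl⟩⟩
    · exact ⟨.vertex a, fun h => absurd h he⟩
  choose p hp using hex
  have hinj : Set.InjOn p (Γ.boundary s) := fun e he e' he' h => by
    obtain ⟨x, h0, h1, hx⟩ := (hp e he).2
    obtain ⟨x', h0', h1', hx'⟩ := (hp e' he').2
    rw [hx, hx'] at h
    cases h
    rfl
  have hdeg : Γ.deg G = Γ.deg E := by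
    rw [← sub_eq_zero, ← deg_sub, hdiv.deg_eq_zero]
  calc (k : ℤ) ≤ (Γ.boundary s).card := by exact_mod_cast hk s ht.1 ht.2.not_gt
    _ = ((Γ.boundary s).image p).card := by rw [Finset.card_image_of_injOn hinj]
    _ ≤ Γ.deg G := card_le_deg hG _ fun q hq => by
        obtain ⟨e, he, rfl⟩ := Finset.mem_image.1 hq
        exact (hp e he).1
    _ = Γ.deg E := hdeg

theorem card_boundary_singleton_le_one {v : Γ.V} (hv : Γ.IsInfinite (.vertex v)) :
    (Γ.boundary {v}).card ≤ 1 := by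
  obtain ⟨e, he, rfl⟩ := isInfinite_vertex_iff.1 hv
  have h := Γ.infinite_end e he
  refine (Finset.card_le_card (t := {e}) fun e' he' => ?_).trans_eq (Finset.card_singleton e)
  rw [mem_boundary, mem_singleton_iff, mem_singleton_iff] at he'
  rw [Finset.mem_singleton]
  by_contra hne
  exact he' (iff_of_false (h.1 e') (mt (h.2 e') hne))

/-- If the degree is smaller than all cuts between the `n` vertices, then two equivalent effective
divisors differ by a function with a common value at these vertices. Truncating it at this value gives
an equivalent effective divisor that contains all those among the vertices that one of the two
contains. Hence there is one that contains all of them. -/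
theorem le_deg_of_cuts {n : ℕ} {v : Fin n → Γ.V} (hv : Function.Injective v)
    (hcut : ∀ (s : Set Γ.V) (i j : Fin n), v i ∈ s → v j ∉ s → n - 1 ≤ (Γ.boundary s).card)
    {D : Γ.Divisor} (hD : ∀ p, ∃ E : Γ.Divisor, 0 ≤ E ∧ 1 ≤ E p ∧
      ∃ f : Γ.PLFun, f.HasDiv (E - D)) : ((n - 1 : ℕ) : ℤ) ≤ Γ.deg D := by
  classical
  by_contra! hlt
  have hdeg : ∀ {E : Γ.Divisor} {f : Γ.PLFun}, f.HasDiv (E - D) → Γ.deg E = Γ.deg D :=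
    fun h => by rw [← sub_eq_zero, ← deg_sub, h.deg_eq_zero]
  obtain ⟨E₀, hE₀, hp₀, f₀, hf₀⟩ := hD (.vertex (Classical.arbitrary Γ.V))
  -- As `1 ≤ deg D < n - 1`, there are at least three vertices `v i`. By the cut condition each of them
  -- has at least two edges, so that it is not infinite.
  have hpos : 1 ≤ Γ.deg D := by
    rw [← hdeg hf₀]
    simpa using card_le_deg hE₀ {.vertex (Classical.arbitrary Γ.V)} (by simpa using hp₀)
  have hn : 2 < n := by omega
  have hfin : ∀ i, ¬ Γ.IsInfinite (.vertex (v i)) := fun i hi => by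
    have : Nontrivial (Fin n) := Fin.nontrivial_iff_two_le.2 hn.le
    obtain ⟨j, hj⟩ := exists_ne i
    have h1 := hcut {v i} i j rfl (fun h => hj (hv h))
    have h2 := card_boundary_singleton_le_one hi
    omega
  have hall : ∀ s : Finset (Fin n), ∃ E : Γ.Divisor, 0 ≤ E ∧ (∀ i ∈ s, 1 ≤ E (.vertex (v i))) ∧
      ∃ f : Γ.PLFun, f.HasDiv (E - D) := by
    intro s
    induction s using Finset.induction_on with
    | empty => exact ⟨E₀, hE₀, by simp, f₀, hf₀⟩
    | insert j s _ ih =>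
      obtain ⟨E, hE, hEs, f, hf⟩ := ih
      obtain ⟨E', hE', hE'j, f', hf'⟩ := hD (.vertex (v j))
      have h1 : (f' - f).HasDiv (E' - E) := by
        convert hf'.sub hf using 1
        abel
      have hconst : ∀ i, (f' - f).val (v i) = (f' - f).val (v j) := fun i => by
        by_contra hne
        refine hlt.not_ge ?_
        rw [← hdeg hf]
        rcases lt_or_gt_of_ne hne with h | h
        · exact le_deg_of_val_lt hE hE' h1 h fun s => hcut s i j
        · exact le_deg_of_val_lt hE hE' h1 h fun s => hcut s j i
      -- The divisor `G - D` is `(G - E) - ((E - D) - (E - D) - (E - D))`.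
      obtain ⟨G, hG, hdiv, hle, -⟩ :=
        PLFun.exists_effective_maxConst hE hE' h1 ((f' - f).val (v j))
      refine ⟨G, hG, fun i hi => ?_, _, by
        convert hdiv.sub ((hf.sub hf).sub hf) using 1
        abel⟩
      have hGi := hle _ (hfin i) (hconst i)
      rcases Finset.mem_insert.1 hi with rfl | hi
      · exact hE'j.trans hGi.2
      · exact (hEs i hi).trans hGi.1
  obtain ⟨E, hE, hEv, f, hf⟩ := hall Finset.univ
  have hcard := card_le_deg hE (Finset.univ.image fun i => Point.vertex (v i)) fun p hp => by
    obtain ⟨i, hi, rfl⟩ := Finset.mem_image.1 hp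
    exact hEv i hi
  rw [Finset.card_image_of_injective _ (fun i j h => hv (Point.vertex.inj h)), Finset.card_univ,
    Fintype.card_fin, hdeg hf] at hcard
  omega

theorem le_gonality_of_cuts {n : ℕ} {v : Fin n → Γ.V} (hv : Function.Injective v)
    (hcut : ∀ (s : Set Γ.V) (i j : Fin n), v i ∈ s → v j ∉ s → n - 1 ≤ (Γ.boundary s).card) :
    ((n - 1 : ℕ) : ℕ∞) ≤ Γ.gonality := by
  refine le_sInf ?_
  rintro _ ⟨d, D, hd, hD, rfl⟩
  have := le_deg_of_cuts hv hcut fun p => exists_effective_of_rank_eq_one hD p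
  rw [hd] at this
  exact_mod_cast this

/-! ### Cuts and paths -/

theorem Walk.exists_mem_boundary {s : Set Γ.V} {u w : Γ.V} (p : Γ.Walk u w)
    (h : ¬ (u ∈ s ↔ w ∈ s)) : ∃ e ∈ p.edges, e ∈ Γ.boundary s := by
  induction p with
  | nil => exact absurd Iff.rfl h
  | @cons u x w d hu hv p ih =>
    by_cases hx : u ∈ s ↔ x ∈ s
    · obtain ⟨e, he, hes⟩ := ih fun h' => h (hx.trans h')
      exact ⟨e, List.mem_cons_of_mem _ he, hes⟩
    · refine ⟨d.1, List.mem_cons_self, mem_boundary.2 ?_⟩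
      subst hu hv
      unfold Dart.start Dart.finish at hx
      split_ifs at hx
      · exact hx
      · exact fun h' => hx h'.symm

/-- The number of pairwise disjoint sets `B k` of edges that all meet a cut bounds its size. -/
theorem card_le_card_boundary {ι : Type*} [Fintype ι] {s : Set Γ.V} {B : ι → Γ.E → Prop}
    (hB : ∀ k, ∃ e, B k e ∧ e ∈ Γ.boundary s) (hdisj : ∀ k l e, B k e → B l e → k = l) :
    Fintype.card ι ≤ (Γ.boundary s).card := by
  classical
  choose e he hes using hB
  rw [← Finset.card_univ]
  refine Finset.card_le_card_of_injOn e (fun k _ => hes k) fun k _ l _ h => ?_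
  exact hdisj k l (e k) (he k) (h ▸ he l)

/-- In a complete graph, a cut that separates `v i` from `v j` meets the segment from `v k` to `v i` or
to `v j`, for each `k ≠ i`. -/
theorem ContainsComplete.exists_cuts {d : ℕ} (h : Γ.ContainsComplete d) :
    ∃ v : Fin d → Γ.V, Function.Injective v ∧ ∀ (s : Set Γ.V) (i j : Fin d), v i ∈ s → v j ∉ s →
      d - 1 ≤ (Γ.boundary s).card := by
  classical
  obtain ⟨v, P, hv, -, hP⟩ := h
  refine ⟨v, hv, fun s i j hi hj => ?_⟩
  have hij : i ≠ j := fun h => hj (h ▸ hi)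
  -- Each `k ≠ i` contributes the segment from `k` to `i` or to `j`, whichever meets the cut.
  set B : {k // k ≠ i} → Γ.E → Prop := fun k e => ∃ a b, a < b ∧ e ∈ (P a b).edges ∧
    ((v k ∈ s ∧ ((a, b) = (k.1, j) ∨ (a, b) = (j, k.1))) ∨
      (v k ∉ s ∧ ((a, b) = (i, k.1) ∨ (a, b) = (k.1, i))))
  have hcard : Fintype.card {k // k ≠ i} = d - 1 := by
    rw [Fintype.card_subtype_compl, Fintype.card_subtype_eq, Fintype.card_fin]
  rw [← hcard]
  refine card_le_card_boundary (B := B) (fun k => ?_) ?_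
  · by_cases hk : v k ∈ s
    · have hkj : k.1 ≠ j := fun h => hj (h ▸ hk)
      rcases lt_or_gt_of_ne hkj with hlt | hlt
      · obtain ⟨e, he, hes⟩ := (P k.1 j).exists_mem_boundary (s := s) (by simp [hk, hj])
        exact ⟨e, ⟨_, _, hlt, he, .inl ⟨hk, .inl rfl⟩⟩, hes⟩
      · obtain ⟨e, he, hes⟩ := (P j k.1).exists_mem_boundary (s := s) (by simp [hk, hj])
        exact ⟨e, ⟨_, _, hlt, he, .inl ⟨hk, .inr rfl⟩⟩, hes⟩
    · rcases lt_or_gt_of_ne k.2 with hlt | hlt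
      · obtain ⟨e, he, hes⟩ := (P k.1 i).exists_mem_boundary (s := s) (by simp [hk, hi])
        exact ⟨e, ⟨_, _, hlt, he, .inr ⟨hk, .inr rfl⟩⟩, hes⟩
      · obtain ⟨e, he, hes⟩ := (P i k.1).exists_mem_boundary (s := s) (by simp [hk, hi])
        exact ⟨e, ⟨_, _, hlt, he, .inr ⟨hk, .inl rfl⟩⟩, hes⟩
  · rintro k l e ⟨a, b, hab, he, hk⟩ ⟨a', b', hab', he', hl⟩
    have heq : (a, b) = (a', b') := by
      by_contra hne
      exact (hP a b a' b' hab hab' hne).1 e he he'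
    have hki := k.2
    have hli := l.2
    ext1
    simp only [Prod.mk.injEq] at heq hk hl
    obtain ⟨rfl, rfl⟩ := heq
    grind

end MetricGraph

theorem mainTheorem5 (Γ : MetricGraph) :
    (∀ (n : ℕ) (v : Fin n → Γ.V), Function.Injective v →
      (∀ i j, i ≠ j → ∃ P : Fin (n - 1) → Γ.Walk (v i) (v j),
        (∀ k, (P k).IsPath) ∧ ∀ k l, k ≠ l → (P k).DisjointExceptEnds (P l)) →
      ((n - 1 : ℕ) : ℕ∞) ≤ Γ.gonality) ∧
    (∀ d : ℕ, Γ.ContainsComplete d → ((d - 1 : ℕ) : ℕ∞) ≤ Γ.gonality) := by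
  refine ⟨fun n v hv hP => MetricGraph.le_gonality_of_cuts hv fun s i j hi hj => ?_,
    fun d hd => ?_⟩
  · obtain ⟨P, -, hdisj⟩ := hP i j fun h => hj (h ▸ hi)
    have := MetricGraph.card_le_card_boundary (B := fun k e => e ∈ (P k).edges)
      (fun k => (P k).exists_mem_boundary (s := s) (by simp [hi, hj]))
      fun k l e hk hl => by_contra fun hne => (hdisj k l hne).1 e hk hl
    simpa using this
  · obtain ⟨v, hv, hcut⟩ := hd.exists_cuts
    exact MetricGraph.le_gonality_of_cuts hv hcut
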